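/- Let $m\ge 1$ and identify the screen plane with $\mathbb R^m$ (for screens in $\mathbb R^n$, $n=2,3$, one has $m=n-1$). Let $\hat u(\xi)=(2\pi)^{-m/2}\int_{\mathbb R^m}e^{-i\xi\cdot x}u(x)\,dx$ for $u\in C_0^\infty(\mathbb R^m)$, extended to tempered distributions, and let $H^{-1/2}=H^{-1/2}(\mathbb R^m)$ be the complex Hilbert space of tempered distributions $u$ on $\mathbb R^m$ whose Fourier transform $\hat u$ is a locally integrable function with $\|u\|^2=\int_{\mathbb R^m}(1+|\xi|^2)^{-1/2}|\hat u(\xi)|^2\,d\xi<\infty$. For open $\Omega\subset\mathbb R^m$ let $\widetilde H^{-1/2}(\Omega)$ be the closure of $C_0^\infty(\Omega)$ in $H^{-1/2}$, and for closed $F\subset\mathbb R^m$ let $H^{-1/2}_F=\{u\in H^{-1/2}:\operatorname{supp}u\subset F\}$. A pre-convex mesh on a non-empty bounded open set $\Omega\subset\mathbb R^m$ is a finite collection $T_1,\dots,T_N$ of non-empty open subsets of $\Omega$ such that the convex hulls of $T_l$ and $T_{l'}$ are disjoint for $l\ne l'$, each boundary $\partial T_l$ has zero $m$-dimensional Lebesgue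 measure, and $\Omega$ is the interior of $\bigcup_{l=1}^N\overline{T_l}$; its mesh size is $h=\max_l\operatorname{diam}(T_l)$. Closed subspaces $W_j$ $(j\in\mathbb N_0)$ of a Hilbert space $H$ Mosco-converge to a closed subspace $W$ if (i) for every $w\in W$ there are $w_j\in W_j$ with $\|w_j-w\|_H\to0$, and (ii) whenever $(W_{j_k})$ is a subsequence, $w_k\in W_{j_k}$ and $w_k\rightharpoonup w$ weakly in $H$, then $w\in W$. **Theorem.** Let $\Gamma$ and $\Gamma_j$, $j\in\mathbb N_0$, be non-empty, bounded, open subsets of $\mathbb R^m$ with $\widetilde H^{-1/2}(\Gamma)=H^{-1/2}_{\overline\Gamma}$. Suppose there are non-empty bounded open sets $\Gamma_j^-$ and non-empty compact sets $\Gamma_j^+$ such that, for all $j\in\mathbb N_0$, $\Gamma_j^-\subset\Gamma_{j+1}^-$, $\Gamma_{j+1}^+\subset\Gamma_j^+$ and $\Gamma_j^-\subset\Gamma_j\subset\Gamma_j^+$, and such that $\Gamma=\bigcup_{j}\Gamma_j^-$ and $\overline\Gamma=\bigcap_j\Gamma_j^+$. For each $j$ let $M_j$ be a pre-convex mesh on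 $\Gamma_j$ with mesh size $h_j$, and let $V_j^h\subset H^{-1/2}$ be the space of those functions in $L^2(\Gamma_j)$, extended by zero to $\mathbb R^m$, that are constant (almost everywhere) on each element of $M_j$. If $h_j\to0$ as $j\to\infty$, then the spaces $V_j^h$ and $\widetilde H^{-1/2}(\Gamma)$ are closed in $H^{-1/2}$, and $V_j^h$ Mosco-converges to $\widetilde H^{-1/2}(\Gamma)$ in $H^{-1/2}$. -/

import Mathlib

open MeasureTheory TemperedDistribution Distribution Filter Topology
open scoped SchwartzMap FourierTransform ENNReal

noncomputable section

/-! ### The Sobolev spaces `H^s(ℝ^m)` -/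

/-- The weight `(1 + |2πξ|²)^{s/2}`. Mathlib's Fourier transform `∫ e^{-2πi⟨x,ξ⟩} u(x) dx` is, up to
the unitary change of variable `ξ ↦ 2πξ`, the one normalised as
`(2π)^{-m/2} ∫ e^{-i⟨x,ξ⟩} u(x) dx`, for which the weight reads `(1 + |ξ|²)^{s/2}`. -/
def sobolevWeight (m : ℕ) (s : ℝ) (ξ : EuclideanSpace ℝ (Fin m)) : ℂ :=
  (((1 + ‖(2 * Real.pi) • ξ‖ ^ 2) ^ (s / 2) : ℝ) : ℂ)

theorem sobolevWeight_hasTemperateGrowth (m : ℕ) (s : ℝ) :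
    (sobolevWeight m s).HasTemperateGrowth := by
  have h := (Function.hasTemperateGrowth_one_add_norm_sq_rpow
    (EuclideanSpace ℝ (Fin m)) (s / 2)).comp
    ((2 * Real.pi) • ContinuousLinearMap.id ℝ (EuclideanSpace ℝ (Fin m))).hasTemperateGrowth
  exact Function.Complex.hasTemperateGrowth_ofReal.comp h

theorem sobolevWeight_mul_neg (m : ℕ) (s : ℝ) :
    sobolevWeight m s * sobolevWeight m (-s) = fun _ => 1 := by
  ext ξ
  have h : (0 : ℝ) < 1 + ‖(2 * Real.pi) • ξ‖ ^ 2 := by positivity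
  simp only [sobolevWeight, Pi.mul_apply]
  rw [← Complex.ofReal_mul, ← Real.rpow_add h]
  simp [neg_div]

theorem smulLeft_sobolevWeight_cancel (m : ℕ) (s : ℝ) (u : 𝓢'(EuclideanSpace ℝ (Fin m), ℂ)) :
    smulLeftCLM ℂ (sobolevWeight m (-s)) (smulLeftCLM ℂ (sobolevWeight m s) u) = u := by
  have h := sobolevWeight_mul_neg m s
  rw [smulLeftCLM_smulLeftCLM_apply (sobolevWeight_hasTemperateGrowth m _)
    (sobolevWeight_hasTemperateGrowth m _)]
  rw [h, smulLeftCLM_const, one_smul]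

/-- The tempered distributions `u` for which `(1 + |ξ|²)^{s/2} û` is a square integrable
function. -/
def sobolevSubmodule (m : ℕ) (s : ℝ) : Submodule ℂ 𝓢'(EuclideanSpace ℝ (Fin m), ℂ) where
  carrier := {u | ∃ f : Lp ℂ 2 (volume : Measure (EuclideanSpace ℝ (Fin m))),
    smulLeftCLM ℂ (sobolevWeight m s) (𝓕 u) = Lp.toTemperedDistributionCLM ℂ volume 2 f}
  zero_mem' := ⟨0, by rw [map_zero, FourierTransform.fourier_zero, map_zero]⟩
  add_mem' := by
    rintro u v ⟨f, hf⟩ ⟨g, hg⟩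
    exact ⟨f + g, by rw [FourierTransform.fourier_add, map_add, map_add, hf, hg]⟩
  smul_mem' := by
    rintro c u ⟨f, hf⟩
    exact ⟨c • f, by rw [FourierTransform.fourier_smul, map_smul, map_smul, hf]⟩

/-- The Sobolev space `H^s(ℝ^m)`, as a type (its Hilbert space structure is installed below). -/
def SobolevSpace (m : ℕ) (s : ℝ) : Type := sobolevSubmodule m s

namespace SobolevSpace

variable {m : ℕ} {s : ℝ}

instance : AddCommGroup (SobolevSpace m s) := inferInstanceAs (AddCommGroup (sobolevSubmodule m s))

instance : Module ℂ (SobolevSpace m s) := inferInstanceAs (Module ℂ (sobolevSubmodule m s))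

/-- The inclusion of `H^s(ℝ^m)` into the tempered distributions. -/
def toDistribution : SobolevSpace m s →ₗ[ℂ] 𝓢'(EuclideanSpace ℝ (Fin m), ℂ) :=
  (sobolevSubmodule m s).subtype

theorem toDistribution_injective :
    Function.Injective (toDistribution : SobolevSpace m s →ₗ[ℂ] _) :=
  Subtype.val_injective

theorem toTemperedDistributionCLM_injective :
    Function.Injective (Lp.toTemperedDistributionCLM ℂ
      (volume : Measure (EuclideanSpace ℝ (Fin m))) 2) :=
  LinearMap.ker_eq_bot.1 Lp.ker_toTemperedDistributionCLM_eq_bot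

/-- The square integrable function `(1 + |ξ|²)^{s/2} û` attached to `u ∈ H^s(ℝ^m)`. -/
def weightedFourierFun (u : SobolevSpace m s) :
    Lp ℂ 2 (volume : Measure (EuclideanSpace ℝ (Fin m))) :=
  u.2.choose

theorem weightedFourierFun_spec (u : SobolevSpace m s) :
    smulLeftCLM ℂ (sobolevWeight m s) (𝓕 (toDistribution u)) =
      Lp.toTemperedDistributionCLM ℂ volume 2 (weightedFourierFun u) :=
  u.2.choose_spec

/-- The linear map `u ↦ (1 + |ξ|²)^{s/2} û` from `H^s(ℝ^m)` to `L²(ℝ^m)`. -/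
def weightedFourier :
    SobolevSpace m s →ₗ[ℂ] Lp ℂ 2 (volume : Measure (EuclideanSpace ℝ (Fin m))) where
  toFun := weightedFourierFun
  map_add' u v := by
    apply toTemperedDistributionCLM_injective
    rw [← weightedFourierFun_spec, map_add, map_add, FourierTransform.fourier_add, map_add,
      weightedFourierFun_spec, weightedFourierFun_spec]
  map_smul' c u := by
    apply toTemperedDistributionCLM_injective
    rw [← weightedFourierFun_spec, map_smul, RingHom.id_apply, map_smul,
      FourierTransform.fourier_smul, map_smul, weightedFourierFun_spec]

theorem weightedFourier_spec (u : SobolevSpace m s) :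
    smulLeftCLM ℂ (sobolevWeight m s) (𝓕 (toDistribution u)) =
      Lp.toTemperedDistributionCLM ℂ volume 2 (weightedFourier u) :=
  weightedFourierFun_spec u

theorem weightedFourier_injective :
    Function.Injective (weightedFourier : SobolevSpace m s →ₗ[ℂ] _) := by
  intro u v h
  apply toDistribution_injective
  have h' := congrArg (Lp.toTemperedDistributionCLM ℂ volume 2) h
  rw [← weightedFourier_spec, ← weightedFourier_spec] at h'
  have h'' := congrArg (smulLeftCLM ℂ (sobolevWeight m (-s))) h'
  rw [smulLeft_sobolevWeight_cancel, smulLeft_sobolevWeight_cancel] at h''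
  simpa using congrArg (fun w => 𝓕⁻ w) h''

theorem weightedFourier_surjective :
    Function.Surjective (weightedFourier : SobolevSpace m s →ₗ[ℂ] _) := by
  intro f
  have hf : smulLeftCLM ℂ (sobolevWeight m s) (𝓕 (𝓕⁻ (smulLeftCLM ℂ (sobolevWeight m (-s))
      (Lp.toTemperedDistributionCLM ℂ volume 2 f)))) =
      Lp.toTemperedDistributionCLM ℂ volume 2 f := by
    rw [FourierTransform.fourier_fourierInv_eq]
    simpa using smulLeft_sobolevWeight_cancel m (-s) (Lp.toTemperedDistributionCLM ℂ volume 2 f)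
  let u : SobolevSpace m s := ⟨_, f, hf⟩
  exact ⟨u, toTemperedDistributionCLM_injective ((weightedFourier_spec u).symm.trans hf)⟩

/-- The norm `‖u‖² = ∫ (1 + |ξ|²)^s |û(ξ)|² dξ`. -/
instance : NormedAddCommGroup (SobolevSpace m s) :=
  NormedAddCommGroup.induced _ _ weightedFourier weightedFourier_injective

/-- The inner product of `H^s(ℝ^m)`, namely `∫ (1 + |ξ|²)^s û(ξ) v̂(ξ) dξ` with the conjugate on
one factor (in Mathlib's convention the first). -/
instance : InnerProductSpace ℂ (SobolevSpace m s) where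
  inner u v := inner ℂ (weightedFourier u) (weightedFourier v)
  norm_smul_le c u := by
    change ‖weightedFourier (c • u)‖ ≤ ‖c‖ * ‖weightedFourier u‖
    rw [map_smul, norm_smul]
  norm_sq_eq_re_inner u := by
    change ‖weightedFourier u‖ ^ 2 = _
    exact norm_sq_eq_re_inner (𝕜 := ℂ) (weightedFourier u)
  conj_inner_symm u v := inner_conj_symm (weightedFourier u) (weightedFourier v)
  add_left u v w := by rw [map_add, inner_add_left]
  smul_left u v c := by rw [map_smul, inner_smul_left]

instance : CompleteSpace (SobolevSpace m s) := by
  let e : SobolevSpace m s ≃ₗᵢ[ℂ] Lp ℂ 2 (volume : Measure (EuclideanSpace ℝ (Fin m))) :=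
    { LinearEquiv.ofBijective weightedFourier
        ⟨weightedFourier_injective, weightedFourier_surjective⟩ with
      norm_map' := fun _ => rfl }
  exact (completeSpace_congr e.isometry.isUniformEmbedding.isUniformInducing.isUniformEmbedding
    (e := e.toEquiv)).2 inferInstance

end SobolevSpace

/-! ### Sobolev spaces on subsets -/

/-- `H^s_F = {u ∈ H^s(ℝ^m) : supp u ⊆ F}`. -/
def sobolevSupported (m : ℕ) (s : ℝ) (F : Set (EuclideanSpace ℝ (Fin m))) :
    Submodule ℂ (SobolevSpace m s) where
  carrier := {u | dsupport u.toDistribution ⊆ F}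
  zero_mem' := by
    intro x hx
    rw [mem_dsupport_iff_not_isVanishingOn] at hx
    exact absurd (fun φ _ => by simp) (hx Set.univ trivial isOpen_univ)
  add_mem' := by
    intro u v hu hv x hx
    by_contra hxF
    have h1 : x ∉ dsupport u.toDistribution := fun h => hxF (hu h)
    have h2 : x ∉ dsupport v.toDistribution := fun h => hxF (hv h)
    rw [notMem_dsupport_iff] at h1 h2
    obtain ⟨s₁, h₁, o₁, x₁⟩ := h1
    obtain ⟨s₂, h₂, o₂, x₂⟩ := h2
    rw [mem_dsupport_iff_not_isVanishingOn] at hx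
    refine hx (s₁ ∩ s₂) ⟨x₁, x₂⟩ (o₁.inter o₂) fun φ hφ => ?_
    have e₁ := h₁ φ (hφ.trans Set.inter_subset_left)
    have e₂ := h₂ φ (hφ.trans Set.inter_subset_right)
    rw [map_add]
    change u.toDistribution φ + v.toDistribution φ = 0
    rw [e₁, e₂, add_zero]
  smul_mem' := by
    intro c u hu x hx
    refine hu ?_
    rw [mem_dsupport_iff_not_isVanishingOn] at hx ⊢
    intro s xs os hv
    refine hx s xs os fun φ hφ => ?_
    rw [map_smul]
    change c • u.toDistribution φ = 0
    rw [hv φ hφ, smul_zero]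

/-- The image of `C_0^∞(Ω)` in `H^s(ℝ^m)`; a compactly supported smooth function is the same thing
as a compactly supported Schwartz function. -/
def testFunctions (m : ℕ) (s : ℝ) (Ω : Set (EuclideanSpace ℝ (Fin m))) :
    Submodule ℂ (SobolevSpace m s) where
  carrier := {u | ∃ φ : 𝓢(EuclideanSpace ℝ (Fin m), ℂ), HasCompactSupport φ ∧ tsupport φ ⊆ Ω ∧
    u.toDistribution = SchwartzMap.toTemperedDistributionCLM _ ℂ volume φ}
  zero_mem' := ⟨0, HasCompactSupport.zero, by
    change tsupport (0 : EuclideanSpace ℝ (Fin m) → ℂ) ⊆ Ω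
    simp, by rw [map_zero, map_zero]⟩
  add_mem' := by
    rintro u v ⟨φ, hc, hs, hu⟩ ⟨ψ, hc', hs', hv⟩
    refine ⟨φ + ψ, HasCompactSupport.add hc hc', ?_, by rw [map_add, map_add, hu, hv]⟩
    exact (tsupport_add (φ : EuclideanSpace ℝ (Fin m) → ℂ) ψ).trans (Set.union_subset hs hs')
  smul_mem' := by
    rintro c u ⟨φ, hc, hs, hu⟩
    refine ⟨c • φ, HasCompactSupport.smul_left (f := fun _ => c) hc, ?_,
      by rw [map_smul, map_smul, hu]⟩
    exact (tsupport_smul_subset_right (fun _ => c) (φ : EuclideanSpace ℝ (Fin m) → ℂ)).trans hs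

/-- `H̃^s(Ω)`, the closure of `C_0^∞(Ω)` in `H^s(ℝ^m)`. -/
def sobolevTilde (m : ℕ) (s : ℝ) (Ω : Set (EuclideanSpace ℝ (Fin m))) :
    Submodule ℂ (SobolevSpace m s) :=
  (testFunctions m s Ω).topologicalClosure

/-! ### Mosco convergence -/

/-- Weak convergence of a sequence in a Hilbert space. -/
def WeaklyConverges {H : Type*} [NormedAddCommGroup H] [InnerProductSpace ℂ H]
    (w : ℕ → H) (w₀ : H) : Prop :=
  ∀ ℓ : H →L[ℂ] ℂ, Tendsto (fun k => ℓ (w k)) atTop (𝓝 (ℓ w₀))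

/-- Mosco convergence of the closed subspaces `W j` to the closed subspace `W₀`. -/
structure MoscoConverges {H : Type*} [NormedAddCommGroup H] [InnerProductSpace ℂ H]
    (W : ℕ → Submodule ℂ H) (W₀ : Submodule ℂ H) : Prop where
  isClosed_seq : ∀ j, IsClosed (W j : Set H)
  isClosed_limit : IsClosed (W₀ : Set H)
  exists_approx : ∀ w ∈ W₀, ∃ v : ℕ → H, (∀ j, v j ∈ W j) ∧
    Tendsto (fun j => ‖v j - w‖) atTop (𝓝 0)
  weak_limit_mem : ∀ σ : ℕ → ℕ, StrictMono σ → ∀ v : ℕ → H, (∀ k, v k ∈ W (σ k)) →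
    ∀ w : H, WeaklyConverges v w → w ∈ W₀

/-! ### Pre-convex meshes and piecewise constant functions -/

/-- A pre-convex mesh on `Ω`. -/
structure PreConvexMesh {m : ℕ} (Ω : Set (EuclideanSpace ℝ (Fin m))) where
  /-- the number of elements -/
  N : ℕ
  /-- the elements -/
  T : Fin N → Set (EuclideanSpace ℝ (Fin m))
  T_nonempty : ∀ l, (T l).Nonempty
  T_isOpen : ∀ l, IsOpen (T l)
  T_subset : ∀ l, T l ⊆ Ω
  disjoint_convexHull : ∀ l l', l ≠ l' → Disjoint (convexHull ℝ (T l)) (convexHull ℝ (T l'))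
  volume_frontier : ∀ l, volume (frontier (T l)) = 0
  eq_interior : Ω = interior (⋃ l, closure (T l))

namespace PreConvexMesh

variable {m : ℕ} {Ω : Set (EuclideanSpace ℝ (Fin m))}

/-- The mesh size: the largest diameter of an element. -/
def meshSize (M : PreConvexMesh Ω) : ℝ := ⨆ l, Metric.diam (M.T l)

/-- The piecewise constant functions on the mesh, that is the `f ∈ L²(Ω)` that are (almost
everywhere) constant on each element, extended by zero to `ℝ^m` and viewed in `H^s(ℝ^m)`. -/
def piecewiseConstants (M : PreConvexMesh Ω) (s : ℝ) : Submodule ℂ (SobolevSpace m s) where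
  carrier := {u | ∃ f : Lp ℂ 2 (volume : Measure (EuclideanSpace ℝ (Fin m))),
    (∀ l, ∃ c : ℂ, ∀ᵐ x, x ∈ M.T l → f x = c) ∧ (∀ᵐ x, x ∉ Ω → f x = 0) ∧
      u.toDistribution = Lp.toTemperedDistributionCLM ℂ volume 2 f}
  zero_mem' := by
    refine ⟨0, fun l => ⟨0, ?_⟩, ?_, by rw [map_zero, map_zero]⟩
    · filter_upwards [Lp.coeFn_zero ℂ 2 (volume : Measure (EuclideanSpace ℝ (Fin m)))] with x hx _
      rw [hx, Pi.zero_apply]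
    · filter_upwards [Lp.coeFn_zero ℂ 2 (volume : Measure (EuclideanSpace ℝ (Fin m)))] with x hx _
      rw [hx, Pi.zero_apply]
  add_mem' := by
    rintro u v ⟨f, hf, hf0, hu⟩ ⟨g, hg, hg0, hv⟩
    refine ⟨f + g, fun l => ?_, ?_, by rw [map_add, map_add, hu, hv]⟩
    · obtain ⟨a, ha⟩ := hf l
      obtain ⟨b, hb⟩ := hg l
      refine ⟨a + b, ?_⟩
      filter_upwards [Lp.coeFn_add f g, ha, hb] with x hx hxa hxb hxl
      rw [hx, Pi.add_apply, hxa hxl, hxb hxl]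
    · filter_upwards [Lp.coeFn_add f g, hf0, hg0] with x hx hxa hxb hxl
      rw [hx, Pi.add_apply, hxa hxl, hxb hxl, add_zero]
  smul_mem' := by
    rintro c u ⟨f, hf, hf0, hu⟩
    refine ⟨c • f, fun l => ?_, ?_, by rw [map_smul, map_smul, hu]⟩
    · obtain ⟨a, ha⟩ := hf l
      refine ⟨c * a, ?_⟩
      filter_upwards [Lp.coeFn_smul c f, ha] with x hx hxa hxl
      rw [hx, Pi.smul_apply, hxa hxl, smul_eq_mul]
    · filter_upwards [Lp.coeFn_smul c f, hf0] with x hx hxa hxl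
      rw [hx, Pi.smul_apply, hxa hxl, smul_zero]

end PreConvexMesh

end

/-!
For `s ≤ 0` the norm of `H^s(ℝ^m)` is dominated by the `L²` norm, since the weight `(1 + |ξ|²)^{s/2}`
is at most one (`SobolevSpace.exists_toDistribution_eq_of_nonpos`). The
argument rests on this and on the continuity of `u ↦ u(φ)` on `H^s(ℝ^m)` for a Schwartz function `φ`
(`SobolevSpace.continuous_toDistribution_apply`).

* The piecewise constant functions on a mesh are spanned by the finitely many indicator functions
  of its elements, because the elements cover `Ω` up to their boundaries, which are null sets. They
  form a finite-dimensional, hence closed, subspace.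
* Approximation: by density it is enough to approximate a test function `φ` supported in `Γ`. By
  compactness its support lies in `Γ_j^- ⊆ Γ_j` for large `j`. Sampling `φ` at one point of each
  element gives a uniform error that tends to zero with the mesh size, by uniform continuity, and
  that vanishes off the fixed compact set `Γ_0^+`; so the error tends to zero in `L²` and in `H^s`.
* Weak limits: an element of the `j`-th space vanishes off `Γ_j^+`. These sets decrease, so a weak
  limit along a subsequence vanishes off each of them, and its support lies in their intersection
  `closure Γ`. The assumption `H̃^s(Γ) = H^s_{closure Γ}` puts it into `H̃^s(Γ)`.
-/

/-! ### Square integrable functions in Sobolev spaces of non-positive order -/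

theorem norm_sobolevWeight_le_one (m : ℕ) {s : ℝ} (hs : s ≤ 0)
    (ξ : EuclideanSpace ℝ (Fin m)) : ‖sobolevWeight m s ξ‖ ≤ 1 := by
  rw [sobolevWeight, Complex.norm_real, Real.norm_of_nonneg (by positivity)]
  exact Real.rpow_le_one_of_one_le_of_nonpos (by simp) (by linarith)

namespace SobolevSpace

variable {m : ℕ} {s : ℝ}

theorem norm_eq_norm_weightedFourier (u : SobolevSpace m s) : ‖u‖ = ‖weightedFourier u‖ := rfl

/-- Square integrable functions embed contractively into `H^s(ℝ^m)` for `s ≤ 0`: the weight is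
then at most one, so that this is Plancherel's theorem. -/
theorem exists_toDistribution_eq_of_nonpos (hs : s ≤ 0)
    (f : Lp ℂ 2 (volume : Measure (EuclideanSpace ℝ (Fin m)))) :
    ∃ u : SobolevSpace m s,
      toDistribution u = Lp.toTemperedDistributionCLM ℂ volume 2 f ∧ ‖u‖ ≤ ‖f‖ := by
  have hw := sobolevWeight_hasTemperateGrowth m s
  have hmem : MemLp (sobolevWeight m s) ∞ volume :=
    memLp_top_of_bound hw.1.continuous.aestronglyMeasurable 1
      (.of_forall (norm_sobolevWeight_le_one m hs))
  set g : Lp ℂ 2 (volume : Measure (EuclideanSpace ℝ (Fin m))) := hmem.toLp _ • 𝓕 f with hg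
  have hsmul : smulLeftCLM ℂ (sobolevWeight m s) (𝓕 (Lp.toTemperedDistributionCLM ℂ volume 2 f)) =
      Lp.toTemperedDistributionCLM ℂ volume 2 g := by
    rw [Lp.toTemperedDistributionCLM_apply, Lp.toTemperedDistributionCLM_apply,
      Lp.fourier_toTemperedDistribution_eq, hg, Lp.toTemperedDistribution_smul_eq hw hmem]
  obtain ⟨u, hu⟩ : ∃ u : SobolevSpace m s,
      toDistribution u = Lp.toTemperedDistributionCLM ℂ volume 2 f := ⟨⟨_, g, hsmul⟩, rfl⟩
  have hug : weightedFourier u = g := by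
    apply toTemperedDistributionCLM_injective
    rw [← weightedFourier_spec, hu, hsmul]
  refine ⟨u, hu, ?_⟩
  calc ‖u‖ = ‖g‖ := by rw [norm_eq_norm_weightedFourier, hug]
    _ ≤ ‖𝓕 f‖ := by
      refine Lp.norm_le_norm_of_ae_le ?_
      filter_upwards [Lp.coeFn_lpSMul (r := 2) (hmem.toLp _) (𝓕 f), hmem.coeFn_toLp] with ξ h h'
      rw [hg, h, Pi.smul_apply', h', norm_smul]
      exact mul_le_of_le_one_left (norm_nonneg _) (norm_sobolevWeight_le_one m hs ξ)
    _ = ‖f‖ := Lp.norm_fourier_eq f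

/-! ### Continuity of evaluation at Schwartz functions -/

/-- Evaluation at a Schwartz function is continuous on `H^s(ℝ^m)`: by the inversion formula `u` is
obtained from the square integrable function `(1 + |ξ|²)^{s/2} û` by continuous operations. -/
theorem continuous_toDistribution_apply (φ : 𝓢(EuclideanSpace ℝ (Fin m), ℂ)) :
    Continuous fun u : SobolevSpace m s => toDistribution u φ := by
  have h : ∀ u : SobolevSpace m s, toDistribution u φ =
      Lp.toTemperedDistributionCLM ℂ volume 2 (weightedFourier u)
        (SchwartzMap.smulLeftCLM ℂ (sobolevWeight m (-s)) (𝓕⁻ φ)) := by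
    intro u
    rw [← smulLeftCLM_apply_apply, ← weightedFourier_spec, smulLeft_sobolevWeight_cancel,
      TemperedDistribution.fourier_apply, FourierTransform.fourier_fourierInv_eq]
  have hW : Continuous (weightedFourier : SobolevSpace m s → _) :=
    (AddMonoidHomClass.isometry_of_norm (weightedFourier : SobolevSpace m s →ₗ[ℂ] _)
      fun u => (norm_eq_norm_weightedFourier u).symm).continuous
  simp_rw [h]
  exact (PointwiseConvergenceCLM.evalCLM (RingHom.id ℂ) ℂ
    (SchwartzMap.smulLeftCLM ℂ (sobolevWeight m (-s)) (𝓕⁻ φ))).continuous.comp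
      ((Lp.toTemperedDistributionCLM ℂ volume 2).continuous.comp hW)

/-- Evaluation at a Schwartz function, as a continuous functional on `H^s(ℝ^m)`. -/
noncomputable def evalCLM (φ : 𝓢(EuclideanSpace ℝ (Fin m), ℂ)) : SobolevSpace m s →L[ℂ] ℂ where
  toFun u := toDistribution u φ
  map_add' u v := by rw [map_add]; rfl
  map_smul' c u := by rw [map_smul]; rfl
  cont := continuous_toDistribution_apply φ

end SobolevSpace

theorem isVanishingOn_of_weaklyConverges {m : ℕ} {s : ℝ} {v : ℕ → SobolevSpace m s}
    {w : SobolevSpace m s} (hw : WeaklyConverges v w) {U : Set (EuclideanSpace ℝ (Fin m))}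
    (hv : ∀ᶠ k in atTop, IsVanishingOn (v k).toDistribution U) :
    IsVanishingOn w.toDistribution U := fun φ hφ =>
  tendsto_nhds_unique (hw (SobolevSpace.evalCLM φ))
    (tendsto_const_nhds.congr' (hv.mono fun _ hk => (hk φ hφ).symm))

theorem isVanishingOn_toTemperedDistributionCLM {m : ℕ}
    {f : Lp ℂ 2 (volume : Measure (EuclideanSpace ℝ (Fin m)))}
    {U : Set (EuclideanSpace ℝ (Fin m))} (hf : ∀ᵐ x, x ∈ U → f x = 0) :
    IsVanishingOn (Lp.toTemperedDistributionCLM ℂ volume 2 f) U := by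
  intro φ hφ
  rw [Lp.toTemperedDistributionCLM_apply, Lp.toTemperedDistribution_apply]
  refine integral_eq_zero_of_ae ?_
  filter_upwards [hf] with x hx
  by_cases hxU : x ∈ U
  · simp [hx hxU]
  · simp [image_eq_zero_of_notMem_tsupport fun h => hxU (hφ h)]

/-! ### Approximation in the closure of a set -/

/-- An approximation property that holds for the elements of a set extends to its closure, and
there yields approximating sequences. -/
theorem exists_seq_tendsto_of_mem_closure {H : Type*} [NormedAddCommGroup H]
    [InnerProductSpace ℂ H] {W : ℕ → Submodule ℂ H} {D : Set H}
    (hD : ∀ u ∈ D, ∀ ε > 0, ∀ᶠ j in atTop, ∃ v ∈ W j, ‖v - u‖ < ε) {w : H}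
    (hw : w ∈ closure D) :
    ∃ v : ℕ → H, (∀ j, v j ∈ W j) ∧ Tendsto (fun j => ‖v j - w‖) atTop (𝓝 0) := by
  have hne : ∀ j, (W j : Set H).Nonempty := fun j => ⟨0, (W j).zero_mem⟩
  have hdist : Tendsto (fun j => Metric.infDist w (W j)) atTop (𝓝 0) := by
    refine tendsto_order.2 ⟨fun a ha => .of_forall fun j => ha.trans_le Metric.infDist_nonneg,
      fun ε hε => ?_⟩
    obtain ⟨u, huD, hwu⟩ := Metric.mem_closure_iff.1 hw (ε / 2) (half_pos hε)
    filter_upwards [hD u huD (ε / 2) (half_pos hε)] with j ⟨v, hvW, hvu⟩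
    calc Metric.infDist w (W j) ≤ dist w v := Metric.infDist_le_dist_of_mem hvW
      _ ≤ dist w u + dist v u := dist_triangle_right _ _ _
      _ < ε := by rw [dist_eq_norm v u]; linarith
  have hv : ∀ j : ℕ, ∃ y ∈ W j, dist w y < Metric.infDist w (W j) + 1 / (j + 1) := fun j =>
    (Metric.infDist_lt_iff (hne j)).1 (lt_add_of_pos_right _ Nat.one_div_pos_of_nat)
  choose v hvW hvd using hv
  have hlim : Tendsto (fun j : ℕ => Metric.infDist w (W j) + 1 / ((j : ℝ) + 1)) atTop (𝓝 0) := by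
    simpa only [add_zero] using hdist.add (tendsto_one_div_add_atTop_nhds_zero_nat (𝕜 := ℝ))
  refine ⟨v, hvW, squeeze_zero (fun _ => norm_nonneg _) (fun j => ?_) hlim⟩
  rw [← dist_eq_norm, dist_comm]
  exact (hvd j).le

/-! ### Piecewise constant functions on a mesh -/

namespace PreConvexMesh

variable {m : ℕ} {Ω : Set (EuclideanSpace ℝ (Fin m))}

theorem ae_exists_mem (M : PreConvexMesh Ω) : ∀ᵐ x, x ∈ Ω → ∃ l, x ∈ M.T l := by
  filter_upwards [ae_all_iff.2 fun l => measure_eq_zero_iff_ae_notMem.1 (M.volume_frontier l)]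
    with x hx hxΩ
  rw [M.eq_interior] at hxΩ
  obtain ⟨l, hl⟩ := Set.mem_iUnion.1 (interior_subset hxΩ)
  refine ⟨l, ?_⟩
  by_contra h
  exact hx l ⟨hl, by rwa [(M.T_isOpen l).interior_eq]⟩

theorem eq_of_mem (M : PreConvexMesh Ω) {l l' : Fin M.N} {x : EuclideanSpace ℝ (Fin m)}
    (h : x ∈ M.T l) (h' : x ∈ M.T l') : l = l' := by
  by_contra hne
  exact Set.disjoint_left.1 (M.disjoint_convexHull l l' hne)
    (subset_convexHull ℝ _ h) (subset_convexHull ℝ _ h')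

theorem diam_le_meshSize (M : PreConvexMesh Ω) (l : Fin M.N) :
    Metric.diam (M.T l) ≤ M.meshSize :=
  le_ciSup (Set.finite_range fun l => Metric.diam (M.T l)).bddAbove l

theorem dist_le_meshSize (M : PreConvexMesh Ω) (hΩ : Bornology.IsBounded Ω) {l : Fin M.N}
    {x y : EuclideanSpace ℝ (Fin m)} (hx : x ∈ M.T l) (hy : y ∈ M.T l) :
    dist x y ≤ M.meshSize :=
  (Metric.dist_le_diam_of_mem (hΩ.subset (M.T_subset l)) hx hy).trans (M.diam_le_meshSize l)

theorem volume_element_ne_top (M : PreConvexMesh Ω) (hΩ : Bornology.IsBounded Ω) (l : Fin M.N) :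
    volume (M.T l) ≠ ∞ :=
  (hΩ.subset (M.T_subset l)).measure_lt_top.ne

/-- The step function taking the value `c l` on the element `T l`. -/
noncomputable def stepFun (M : PreConvexMesh Ω) (hΩ : Bornology.IsBounded Ω) (c : Fin M.N → ℂ) :
    Lp ℂ 2 (volume : Measure (EuclideanSpace ℝ (Fin m))) :=
  ∑ l, c l • indicatorConstLp 2 (M.T_isOpen l).measurableSet (M.volume_element_ne_top hΩ l) (1 : ℂ)

theorem stepFun_ae (M : PreConvexMesh Ω) (hΩ : Bornology.IsBounded Ω) (c : Fin M.N → ℂ) :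
    ∀ᵐ x, (∀ l, x ∈ M.T l → M.stepFun hΩ c x = c l) ∧ (x ∉ Ω → M.stepFun hΩ c x = 0) := by
  have h1 : ∀ᵐ x, ∀ l, (c l • indicatorConstLp 2 (M.T_isOpen l).measurableSet
      (M.volume_element_ne_top hΩ l) (1 : ℂ) : Lp ℂ 2 volume) x =
        (M.T l).indicator (fun _ => c l) x := by
    refine ae_all_iff.2 fun l => ?_
    filter_upwards [Lp.coeFn_smul (c l) (indicatorConstLp 2 (M.T_isOpen l).measurableSet
      (M.volume_element_ne_top hΩ l) (1 : ℂ)), indicatorConstLp_coeFn (p := 2)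
      (hs := (M.T_isOpen l).measurableSet) (hμs := M.volume_element_ne_top hΩ l) (c := (1 : ℂ))]
      with x hx hx'
    rw [hx, Pi.smul_apply, hx']
    by_cases h : x ∈ M.T l <;> simp [h]
  have h2 := Lp.coeFn_finsetSum Finset.univ fun l => c l • indicatorConstLp 2
    (M.T_isOpen l).measurableSet (M.volume_element_ne_top hΩ l) (1 : ℂ)
  filter_upwards [h1, h2] with x hx hs
  rw [stepFun, hs]
  simp only [Finset.sum_apply, hx]
  refine ⟨fun l hl => ?_, fun hxΩ => ?_⟩
  · rw [Finset.sum_eq_single l (fun l' _ hne => Set.indicator_of_notMem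
      (fun h => hne (M.eq_of_mem h hl)) _) (by simp), Set.indicator_of_mem hl]
  · exact Finset.sum_eq_zero fun l _ => Set.indicator_of_notMem (fun h => hxΩ (M.T_subset l h)) _

theorem exists_ae_eq_stepFun (M : PreConvexMesh Ω) (hΩ : Bornology.IsBounded Ω)
    {f : Lp ℂ 2 (volume : Measure (EuclideanSpace ℝ (Fin m)))}
    (hf : ∀ l, ∃ c : ℂ, ∀ᵐ x, x ∈ M.T l → f x = c) (hf0 : ∀ᵐ x, x ∉ Ω → f x = 0) :
    ∃ c, f = M.stepFun hΩ c := by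
  choose c hc using hf
  refine ⟨c, Lp.ext ?_⟩
  filter_upwards [ae_all_iff.2 hc, hf0, M.stepFun_ae hΩ c, M.ae_exists_mem] with x h1 h2 h3 h4
  by_cases hx : x ∈ Ω
  · obtain ⟨l, hl⟩ := h4 hx
    rw [h1 l hl, h3.1 l hl]
  · rw [h2 hx, h3.2 hx]

theorem mem_piecewiseConstants_of_stepFun (M : PreConvexMesh Ω) (hΩ : Bornology.IsBounded Ω)
    {s : ℝ} {c : Fin M.N → ℂ} {u : SobolevSpace m s}
    (hu : u.toDistribution = Lp.toTemperedDistributionCLM ℂ volume 2 (M.stepFun hΩ c)) :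
    u ∈ M.piecewiseConstants s := by
  refine ⟨M.stepFun hΩ c, fun l => ⟨c l, ?_⟩, ?_, hu⟩
  · filter_upwards [M.stepFun_ae hΩ c] with x hx using hx.1 l
  · filter_upwards [M.stepFun_ae hΩ c] with x hx using hx.2

/-- The piecewise constant functions are spanned by the indicator functions of the elements, of
which there are finitely many; a finite-dimensional subspace is closed. -/
theorem isClosed_piecewiseConstants (M : PreConvexMesh Ω) (hΩ : Bornology.IsBounded Ω) {s : ℝ}
    (hs : s ≤ 0) : IsClosed (M.piecewiseConstants s : Set (SobolevSpace m s)) := by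
  choose e he _ using fun l => SobolevSpace.exists_toDistribution_eq_of_nonpos hs
    (indicatorConstLp 2 (M.T_isOpen l).measurableSet (M.volume_element_ne_top hΩ l) (1 : ℂ))
  have hle : M.piecewiseConstants s ≤ Submodule.span ℂ (Set.range e) := by
    rintro u ⟨f, hf, hf0, hu⟩
    obtain ⟨c, rfl⟩ := M.exists_ae_eq_stepFun hΩ hf hf0
    have hsum : u = ∑ l, c l • e l := by
      apply SobolevSpace.toDistribution_injective
      simp only [hu, stepFun, map_sum, map_smul, he]
    rw [hsum]
    exact Submodule.sum_mem _ fun l _ => Submodule.smul_mem _ _ (Submodule.subset_span ⟨l, rfl⟩)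
  have : FiniteDimensional ℂ (Submodule.span ℂ (Set.range e)) :=
    FiniteDimensional.span_of_finite ℂ (Set.finite_range e)
  have : FiniteDimensional ℂ (M.piecewiseConstants s) := Submodule.finiteDimensional_of_le hle
  exact Submodule.closed_of_finiteDimensional _

theorem isVanishingOn_of_mem_piecewiseConstants (M : PreConvexMesh Ω) {s : ℝ}
    {u : SobolevSpace m s} (hu : u ∈ M.piecewiseConstants s) :
    IsVanishingOn u.toDistribution Ωᶜ := by
  obtain ⟨f, -, hf0, hu⟩ := hu
  rw [hu]
  exact isVanishingOn_toTemperedDistributionCLM hf0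

/-- Sampling a test function supported in `Ω` at one point of each element approximates it within
its largest oscillation over an element, in the supremum norm and hence in `L²` and in `H^s` for
`s ≤ 0`. -/
theorem exists_mem_piecewiseConstants_norm_sub_le (M : PreConvexMesh Ω) {s : ℝ} (hs : s ≤ 0)
    {K : Set (EuclideanSpace ℝ (Fin m))} (hK : IsCompact K) (hΩK : Ω ⊆ K)
    {φ : 𝓢(EuclideanSpace ℝ (Fin m), ℂ)} (hφ : tsupport φ ⊆ Ω) {δ : ℝ} (hδ : 0 ≤ δ)
    (hosc : ∀ l, ∀ x ∈ M.T l, ∀ y ∈ M.T l, ‖φ x - φ y‖ ≤ δ) {u : SobolevSpace m s}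
    (hu : u.toDistribution = SchwartzMap.toTemperedDistributionCLM _ ℂ volume φ) :
    ∃ v ∈ M.piecewiseConstants s, ‖v - u‖ ≤ δ * volume.real K ^ (1 / 2 : ℝ) := by
  have hΩ : Bornology.IsBounded Ω := hK.isBounded.subset hΩK
  choose p hp using M.T_nonempty
  set f := M.stepFun hΩ fun l => φ (p l) with hf
  have hφ0 : ∀ x ∉ Ω, φ x = 0 := fun x hx => image_eq_zero_of_notMem_tsupport fun h => hx (hφ h)
  have hbound : ‖f - φ.toLp 2 volume‖ ≤ δ * volume.real K ^ (1 / 2 : ℝ) := by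
    calc ‖f - φ.toLp 2 volume‖
        ≤ ‖indicatorConstLp 2 hK.measurableSet hK.measure_lt_top.ne δ‖ := by
          refine Lp.norm_le_norm_of_ae_le ?_
          filter_upwards [Lp.coeFn_sub f (φ.toLp 2 volume), φ.coeFn_toLp 2 volume,
            M.stepFun_ae hΩ fun l => φ (p l), M.ae_exists_mem, indicatorConstLp_coeFn (p := 2)
              (hs := hK.measurableSet) (hμs := hK.measure_lt_top.ne) (c := δ)] with x h1 h2 h3 h4 h5
          rw [h1, Pi.sub_apply, h2, h5]
          by_cases hx : x ∈ Ω
          · obtain ⟨l, hl⟩ := h4 hx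
            rw [hf, h3.1 l hl, Set.indicator_of_mem (hΩK hx), Real.norm_of_nonneg hδ]
            exact hosc l _ (hp l) _ hl
          · rw [hf, h3.2 hx, hφ0 x hx, sub_zero, norm_zero]
            exact norm_nonneg _
      _ = δ * volume.real K ^ (1 / 2 : ℝ) := by
          rw [norm_indicatorConstLp (by simp) (by simp), Real.norm_of_nonneg hδ,
            ENNReal.toReal_ofNat]
  obtain ⟨v, hv, -⟩ := SobolevSpace.exists_toDistribution_eq_of_nonpos hs f
  obtain ⟨d, hd, hdn⟩ := SobolevSpace.exists_toDistribution_eq_of_nonpos hs (f - φ.toLp 2 volume)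
  have hvu : v - u = d := by
    apply SobolevSpace.toDistribution_injective
    rw [map_sub, hv, hu, hd, map_sub, Lp.toTemperedDistributionCLM_apply (φ.toLp 2 volume),
      Lp.toTemperedDistribution_toLp_eq]
  exact ⟨v, M.mem_piecewiseConstants_of_stepFun hΩ hv, hvu ▸ hdn.trans hbound⟩

end PreConvexMesh

/-! ### Mosco convergence -/

theorem IsCompact.eventually_subset_of_monotone {X : Type*} [TopologicalSpace X] {K : Set X}
    (hK : IsCompact K) {U : ℕ → Set X} (hU : Monotone U) (hUo : ∀ j, IsOpen (U j))
    (hKU : K ⊆ ⋃ j, U j) : ∀ᶠ j in atTop, K ⊆ U j := by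
  obtain ⟨J, hJ⟩ := hK.elim_directed_cover U hUo hKU hU.directed_le
  filter_upwards [eventually_ge_atTop J] with j hj using hJ.trans (hU hj)

/-- A test function whose support lies in almost all of the meshed sets is a limit of piecewise
constant functions when the mesh size tends to zero. -/
theorem eventually_exists_mem_piecewiseConstants {m : ℕ} {s : ℝ} (hs : s ≤ 0)
    {Ω : ℕ → Set (EuclideanSpace ℝ (Fin m))} (M : ∀ j, PreConvexMesh (Ω j))
    {K : Set (EuclideanSpace ℝ (Fin m))} (hK : IsCompact K) (hΩK : ∀ j, Ω j ⊆ K)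
    (hM : Tendsto (fun j => (M j).meshSize) atTop (𝓝 0))
    {φ : 𝓢(EuclideanSpace ℝ (Fin m), ℂ)} (hc : HasCompactSupport φ)
    (hφ : ∀ᶠ j in atTop, tsupport φ ⊆ Ω j) {u : SobolevSpace m s}
    (hu : u.toDistribution = SchwartzMap.toTemperedDistributionCLM _ ℂ volume φ)
    {ε : ℝ} (hε : 0 < ε) :
    ∀ᶠ j in atTop, ∃ v ∈ (M j).piecewiseConstants s, ‖v - u‖ < ε := by
  -- The oscillation `δ` is chosen so that `δ * |K| ^ (1 / 2) < ε`; dividing by `C + 1` covers a null set `K`.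
  set C : ℝ := volume.real K ^ (1 / 2 : ℝ) with hC
  have hC0 : 0 ≤ C := by positivity
  set δ : ℝ := ε / (C + 1) with hδ
  have hδ0 : 0 < δ := by positivity
  have hδC : δ * C < ε := by
    rw [hδ, div_mul_eq_mul_div, div_lt_iff₀ (by positivity)]
    nlinarith
  obtain ⟨η, hη, hηφ⟩ := Metric.uniformContinuous_iff.1
    (hc.uniformContinuous_of_continuous φ.continuous) δ hδ0
  filter_upwards [hφ, hM.eventually_lt_const hη] with j hj hjη
  obtain ⟨v, hv, hvu⟩ := (M j).exists_mem_piecewiseConstants_norm_sub_le hs hK (hΩK j) hj hδ0.le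
    (fun l x hx y hy => (dist_eq_norm (φ x) (φ y)).symm.trans_le (hηφ
      (((M j).dist_le_meshSize (hK.isBounded.subset (hΩK j)) hx hy).trans_lt hjη)).le) hu
  exact ⟨v, hv, hvu.trans_lt hδC⟩

/-- The support of a weak limit of elements of `H^s(ℝ^m)` that vanish off a decreasing sequence of
closed sets lies in the intersection of that sequence. -/
theorem mem_sobolevSupported_iInter_of_weaklyConverges {m : ℕ} {s : ℝ}
    {F : ℕ → Set (EuclideanSpace ℝ (Fin m))} (hF : Antitone F) (hFc : ∀ j, IsClosed (F j))
    {σ : ℕ → ℕ} (hσ : StrictMono σ) {v : ℕ → SobolevSpace m s}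
    (hv : ∀ k, IsVanishingOn (v k).toDistribution (F (σ k))ᶜ) {w : SobolevSpace m s}
    (hw : WeaklyConverges v w) : w ∈ sobolevSupported m s (⋂ j, F j) := by
  refine Set.subset_iInter fun J => Set.sInter_subset_of_mem ⟨?_, hFc J⟩
  refine isVanishingOn_of_weaklyConverges hw ?_
  filter_upwards [eventually_ge_atTop J] with k hk
  exact (hv k).mono (Set.compl_subset_compl.2 (hF (hk.trans (hσ.id_le k))))

theorem theorem4p3 (m : ℕ) (hm : 1 ≤ m)
    (Γ : Set (EuclideanSpace ℝ (Fin m)))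
    (Γseq Γminus Γplus : ℕ → Set (EuclideanSpace ℝ (Fin m)))
    (hΓ_nonempty : Γ.Nonempty) (hΓ_bounded : Bornology.IsBounded Γ) (hΓ_open : IsOpen Γ)
    (hΓseq_nonempty : ∀ j, (Γseq j).Nonempty)
    (hΓseq_bounded : ∀ j, Bornology.IsBounded (Γseq j))
    (hΓseq_open : ∀ j, IsOpen (Γseq j))
    (hΓminus_nonempty : ∀ j, (Γminus j).Nonempty)
    (hΓminus_bounded : ∀ j, Bornology.IsBounded (Γminus j))
    (hΓminus_open : ∀ j, IsOpen (Γminus j))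
    (hΓplus_nonempty : ∀ j, (Γplus j).Nonempty)
    (hΓplus_compact : ∀ j, IsCompact (Γplus j))
    (h_tilde : sobolevTilde m (-(1 / 2)) Γ = sobolevSupported m (-(1 / 2)) (closure Γ))
    (hΓminus_mono : ∀ j, Γminus j ⊆ Γminus (j + 1))
    (hΓplus_anti : ∀ j, Γplus (j + 1) ⊆ Γplus j)
    (h_lower : ∀ j, Γminus j ⊆ Γseq j)
    (h_upper : ∀ j, Γseq j ⊆ Γplus j)
    (h_union : Γ = ⋃ j, Γminus j)
    (h_inter : closure Γ = ⋂ j, Γplus j)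
    (M : ∀ j, PreConvexMesh (Γseq j))
    (h_size : Tendsto (fun j => (M j).meshSize) atTop (𝓝 0)) :
    MoscoConverges (fun j => (M j).piecewiseConstants (-(1 / 2)))
      (sobolevTilde m (-(1 / 2)) Γ) := by
  have hs : (-(1 / 2) : ℝ) ≤ 0 := by norm_num
  have hanti : Antitone Γplus := antitone_nat_of_succ_le hΓplus_anti
  refine ⟨fun j => (M j).isClosed_piecewiseConstants (hΓseq_bounded j) hs,
    Submodule.isClosed_topologicalClosure _, fun w hw => ?_, fun σ hσ v hv w hw => ?_⟩
  · have hw' : w ∈ closure (testFunctions m (-(1 / 2)) Γ : Set (SobolevSpace m (-(1 / 2)))) := hw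
    refine exists_seq_tendsto_of_mem_closure ?_ hw'
    rintro u ⟨φ, hc, hφΓ, hu⟩ ε hε
    refine eventually_exists_mem_piecewiseConstants hs M (hΓplus_compact 0)
      (fun j => (h_upper j).trans (hanti j.zero_le)) h_size hc ?_ hu hε
    exact (hc.isCompact.eventually_subset_of_monotone (monotone_nat_of_le_succ hΓminus_mono)
      hΓminus_open (h_union ▸ hφΓ)).mono fun j hj => hj.trans (h_lower j)
  · rw [h_tilde, h_inter]
    exact mem_sobolevSupported_iInter_of_weaklyConverges hanti
      (fun j => (hΓplus_compact j).isClosed) hσ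
      (fun k => ((M (σ k)).isVanishingOn_of_mem_piecewiseConstants (hv k)).mono
        (Set.compl_subset_compl.2 (h_upper _))) hw
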